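/- **Random chain.** For $n\ge 1$ let $PG_n$ be the following random graph on $5n$ vertices. It consists of $n$ pentagons ($5$-cycles) $O_1,\dots,O_n$, the vertices of each being labelled $x_1,\dots,x_5$ in cyclic order, together with, for each $1\le k<n$, one edge joining a random vertex $u_k$ of $O_k$ to the vertex $x_1$ of $O_{k+1}$. For $k\ge 2$ the vertex $u_k$ is not the vertex $x_1$ of $O_k$ (the vertex $u_1$ of $O_1$ is arbitrary). For $n\ge2$ put $Z_n^1=1$ if $u_n$ is the vertex $x_2$ or $x_5$ of $O_n$, and $Z_n^1=0$ otherwise; put $Z_n^2=1$ if $u_n$ is the vertex $x_3$ or $x_4$ of $O_n$, and $Z_n^2=0$ otherwise. For a finite graph $G$, the Schultz index is $$S(G)=\frac12\sum_{u}\sum_{v}\big(d(u)+d(v)\big)\,d(u,v),$$ where $d(u)$ is the degree of $u$ and $d(u,v)$ is the graph distance. **Theorem 3.2.** Suppose that the pairs $(Z_n^1,Z_n^2)$, $n\ge 2$, are independent, that $\mathbb P(Z_n^i=1)=p_i$ and $\mathbb P(Z_n^i=0)=1-p_i$ for all $n\ge2$ and $i\in\{1,2\}$, where $p_1$ and $p_2=1-p_1$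 do not depend on $n$, and that $0<p_i<1$ for $i\in\{1,2\}$. Let $$\begin{aligned} \sigma_2^2&=240^2p_1+360^2(1-p_1)-\big(240p_1+360(1-p_1)\big)^2,\\ \tilde\sigma_2^2&=113^2p_1+233^2(1-p_1)-\big(113p_1+233(1-p_1)\big)^2,\\ r_2&=240\cdot113\,p_1+360\cdot233\,(1-p_1)-\big(240p_1+360(1-p_1)\big)\big(113p_1+233(1-p_1)\big); \end{aligned}$$ for every $n\ge 2$ these are $\sigma_2^2=\mathrm{Var}(U_n')$, $\tilde\sigma_2^2=\mathrm{Var}(V_n')$ and $r_2=\mathrm{Cov}(U_n',V_n')$, where $U_n'=240Z_n^1+360Z_n^2$ and $V_n'=113Z_n^1+233Z_n^2$. (i) For every $n\ge1$, $S(PG_n)$ is square integrable and $$\begin{aligned}\mathrm{Var}\big(S(PG_n)\big)=\frac1{30}\Big(&\sigma_2^2n^5-5r_2n^4+10\tilde\sigma_2^2n^3+(65r_2-30\sigma_2^2-45\tilde\sigma_2^2)n^2\\&+(59\sigma_2^2+65\tilde\sigma_2^2-120r_2)n+(60r_2-30\sigma_2^2-30\tilde\sigma_2^2)\Big).\end{aligned}$$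 (ii) $S(PG_n)$ is asymptotically normal: $$\lim_{n\to\infty}\sup_{a\in\mathbb R}\left|\mathbb P\left(\frac{S(PG_n)-\mathbb E(S(PG_n))}{\sqrt{\mathrm{Var}(S(PG_n))}}\le a\right)-\int_{-\infty}^a\frac1{\sqrt{2\pi}}e^{-t^2/2}\,dt\right|=0.$$ -/

import Mathlib

open MeasureTheory ProbabilityTheory Filter Topology

/-- The Schultz index `S(G) = ½ ∑_u ∑_v (d(u) + d(v)) d(u, v)` of a finite simple graph. -/
noncomputable def schultzIndex {V : Type*} [Fintype V] (G : SimpleGraph V)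
    [DecidableRel G.Adj] : ℝ :=
  (1 / 2 : ℝ) * ∑ u : V, ∑ v : V, ((G.degree u : ℝ) + (G.degree v : ℝ)) * (G.dist u v : ℝ)

/-- The pair `(i, x)` is the vertex `x_{x+1}` of the pentagon `O_{i+1}`: pentagons and the vertices
of a pentagon are both counted from `0` here. `PGLink n a v w` says that `v` lies in some pentagon
`O_k` with `k < n`, is its chosen vertex `a k`, and that `w` is the vertex `x₁` of `O_{k+1}`. -/
def PGLink (n : ℕ) (a : ℕ → Fin 5) (v w : Fin n × Fin 5) : Prop :=
  (v.1 : ℕ) + 1 = (w.1 : ℕ) ∧ v.2 = a (w.1 : ℕ) ∧ w.2 = 0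

/-- The pentagonal chain with `n` pentagons `O_1, …, O_n`. Each pentagon is a `5`-cycle
`x₁ x₂ x₃ x₄ x₅`, and for `1 ≤ k < n` the vertex `u_k = a k` of `O_k` is joined by an edge to the
vertex `x₁` of `O_{k+1}`. -/
def PG (n : ℕ) (a : ℕ → Fin 5) : SimpleGraph (Fin n × Fin 5) where
  Adj v w := (v.1 = w.1 ∧ (SimpleGraph.cycleGraph 5).Adj v.2 w.2) ∨ PGLink n a v w ∨ PGLink n a w v
  symm := ⟨by
    rintro v w (⟨h, h'⟩ | h | h)
    · exact Or.inl ⟨h.symm, h'.symm⟩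
    · exact Or.inr (Or.inr h)
    · exact Or.inr (Or.inl h)⟩
  loopless := ⟨by
    rintro v (⟨_, h⟩ | h | h)
    · exact h.ne rfl
    · have := h.1
      omega
    · have := h.1
      omega⟩

instance (n : ℕ) (a : ℕ → Fin 5) : DecidableRel (PG n a).Adj := fun v w =>
  inferInstanceAs (Decidable ((v.1 = w.1 ∧ (SimpleGraph.cycleGraph 5).Adj v.2 w.2) ∨
    ((v.1 : ℕ) + 1 = (w.1 : ℕ) ∧ v.2 = a (w.1 : ℕ) ∧ w.2 = 0) ∨
    ((w.1 : ℕ) + 1 = (v.1 : ℕ) ∧ w.2 = a (v.1 : ℕ) ∧ v.2 = 0)))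

/-- The indicator `Z¹_n` of the first way of attaching `O_{n+1}` to `PG_n`: the attaching vertex
`u_n` of `O_n` is `x₂` or `x₅`, a neighbour of `x₁`. -/
def choiceOne {Ω : Type*} (u : ℕ → Ω → Fin 5) (n : ℕ) (ω : Ω) : ℝ :=
  if u n ω = 1 ∨ u n ω = 4 then 1 else 0

/-- The indicator `Z²_n` of the second way of attaching `O_{n+1}` to `PG_n`: the attaching vertex
`u_n` of `O_n` is `x₃` or `x₄`, at distance two from `x₁`. -/
def choiceTwo {Ω : Type*} (u : ℕ → Ω → Fin 5) (n : ℕ) (ω : Ω) : ℝ :=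
  if u n ω = 2 ∨ u n ω = 3 then 1 else 0

/-- The random variable `S(PG_n)`, where `u k` is the random attaching vertex of `O_k`. -/
noncomputable def schultzPG {Ω : Type*} (u : ℕ → Ω → Fin 5) (n : ℕ) (ω : Ω) : ℝ :=
  schultzIndex (PG n fun k => u k ω)

/-- `σ₂²` as a function of `p₁`. -/
def sigmaSq (p₁ : ℝ) : ℝ :=
  240 ^ 2 * p₁ + 360 ^ 2 * (1 - p₁) - (240 * p₁ + 360 * (1 - p₁)) ^ 2

/-- `σ̃₂²` as a function of `p₁`. -/
def sigmaTildeSq (p₁ : ℝ) : ℝ :=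
  113 ^ 2 * p₁ + 233 ^ 2 * (1 - p₁) - (113 * p₁ + 233 * (1 - p₁)) ^ 2

/-- `r₂` as a function of `p₁`. -/
def rTwo (p₁ : ℝ) : ℝ :=
  240 * 113 * p₁ + 360 * 233 * (1 - p₁) -
    (240 * p₁ + 360 * (1 - p₁)) * (113 * p₁ + 233 * (1 - p₁))

/-! The randomness enters `S(PG_n)` affinely. Number the pentagons `0, …, N` with `N = n - 1`, and
let `l m` be the distance in pentagon `m` between `x₁` and its attaching vertex. A path from
pentagon `i` to pentagon `j > i` crosses each pentagon strictly between them at cost `l m`, and the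
degrees in a pentagon add up to 10 plus its number of links. Two inner pentagons thus give `l m` the
weight `5 * (12 + 12) = 120`; an end pentagon loses 5. This loss is made up exactly by the pairs
that have pentagon `m` as an endpoint, where the extra degree of a linked vertex contributes `5 * l
m`. The coefficient of `l m` is therefore `120 m (N - m)` (`exists_schultzIndex_PG_eq`).

For `1 ≤ m < N` the attaching vertex is not `x₁`, so `l m = 1 + Z²`, and `S` is a constant plus a
weighted sum of independent Bernoulli variables (`exists_schultzPG_eq`). The variance is then a sum
of squared weights. Normality holds because the largest squared weight is of order `n⁴` and their
sum of order `n⁵`: characteristic functions converge (`tendsto_charFun_weighted_sum`), hence so do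
distribution functions, uniformly by Pólya's theorem (`tendsto_iSup_abs_sub_gaussian`). -/

/-! ### Distances in the chain -/

/-- A potential that vanishes at `u`, drops by at most one along every edge, and drops by exactly one
along some edge at every vertex other than `u`, is the distance from `u`. -/
theorem SimpleGraph.dist_eq_of_potential {V : Type*} (G : SimpleGraph V) (u : V) (f : V → ℕ)
    (h0 : f u = 0) (h1 : ∀ v w, G.Adj v w → f v ≤ f w + 1)
    (h2 : ∀ v, v ≠ u → ∃ w, G.Adj v w ∧ f w + 1 = f v) (v : V) : G.dist u v = f v := by
  have upper : ∀ k v, f v = k → ∃ p : G.Walk v u, p.length = k := by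
    intro k
    induction k with
    | zero =>
      intro v hv
      by_cases h : v = u
      · subst h; exact ⟨.nil, rfl⟩
      · obtain ⟨w, -, hw⟩ := h2 v h
        omega
    | succ k ih =>
      intro v hv
      have h : v ≠ u := by rintro rfl; omega
      obtain ⟨w, hvw, hw⟩ := h2 v h
      obtain ⟨p, hp⟩ := ih w (by omega)
      exact ⟨.cons hvw p, by simp [hp]⟩
  have lower : ∀ v w (p : G.Walk v w), f v ≤ f w + p.length := by
    intro v w p
    induction p with
    | nil => simp
    | cons h p ih =>
      have := h1 _ _ h
      rw [SimpleGraph.Walk.length_cons]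
      omega
  obtain ⟨p, hp⟩ := upper _ v rfl
  rw [SimpleGraph.dist_comm]
  refine le_antisymm (hp ▸ SimpleGraph.dist_le p) ?_
  -- Reachability is needed here: `dist` is 0 by default between unconnected vertices.
  obtain ⟨q, hq⟩ := p.reachable.exists_walk_length_eq_dist
  have := lower _ _ q
  omega

/-- The distance of two vertices of a pentagon. -/
def pentagonDist (x y : Fin 5) : ℕ := min (x - y).val (y - x).val

theorem pentagonDist_self (x : Fin 5) : pentagonDist x x = 0 := by
  simp [pentagonDist]

theorem pentagonDist_le_of_adj : ∀ x y z : Fin 5, (SimpleGraph.cycleGraph 5).Adj y z →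
    pentagonDist x y ≤ pentagonDist x z + 1 := by
  decide

theorem exists_adj_pentagonDist : ∀ x y : Fin 5, y ≠ x →
    ∃ z, (SimpleGraph.cycleGraph 5).Adj y z ∧ pentagonDist x z + 1 = pentagonDist x y := by
  decide

theorem pentagonDist_comm (x y : Fin 5) : pentagonDist x y = pentagonDist y x := by
  simp [pentagonDist, min_comm]

theorem sum_pentagonDist : ∀ x : Fin 5, ∑ y, pentagonDist x y = 6 := by
  decide

/-- The length of the path from the chosen vertex of the `i`-th pentagon to the first vertex of the
`j`-th pentagon, for `i < j`, where pentagons are counted from `0`. -/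
def gapDist (a : ℕ → Fin 5) (i j : ℕ) : ℕ :=
  1 + ∑ m ∈ Finset.Ico (i + 1) j, (pentagonDist 0 (a (m + 1)) + 1)

theorem gapDist_succ_self (a : ℕ → Fin 5) (i : ℕ) : gapDist a i (i + 1) = 1 := by
  simp [gapDist]

theorem gapDist_succ_right (a : ℕ → Fin 5) {i j : ℕ} (h : i < j) :
    gapDist a i (j + 1) = gapDist a i j + (pentagonDist 0 (a (j + 1)) + 1) := by
  rw [gapDist, gapDist, Finset.sum_Ico_succ_top (by omega), add_assoc]

theorem gapDist_succ_left (a : ℕ → Fin 5) {i j : ℕ} (h : i + 1 < j) :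
    gapDist a i j = gapDist a (i + 1) j + (pentagonDist 0 (a (i + 2)) + 1) := by
  rw [gapDist, gapDist, Finset.sum_eq_sum_Ico_succ_bot h]
  ring

/-- The distance from the vertex `(i, x)` to the vertex `(j, y)` of a pentagonal chain. -/
def chainDist (a : ℕ → Fin 5) (i : ℕ) (x : Fin 5) (j : ℕ) (y : Fin 5) : ℕ :=
  if i < j then pentagonDist x (a (i + 1)) + gapDist a i j + pentagonDist 0 y
  else if j < i then pentagonDist 0 x + gapDist a j i + pentagonDist (a (j + 1)) y
  else pentagonDist x y

theorem chainDist_of_lt (a : ℕ → Fin 5) {i j : ℕ} (h : i < j) (x y : Fin 5) :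
    chainDist a i x j y = pentagonDist x (a (i + 1)) + gapDist a i j + pentagonDist 0 y := by
  rw [chainDist, if_pos h]

theorem chainDist_of_gt (a : ℕ → Fin 5) {i j : ℕ} (h : j < i) (x y : Fin 5) :
    chainDist a i x j y = pentagonDist 0 x + gapDist a j i + pentagonDist (a (j + 1)) y := by
  rw [chainDist, if_neg (by omega), if_pos h]

theorem chainDist_self (a : ℕ → Fin 5) (i : ℕ) (x y : Fin 5) :
    chainDist a i x i y = pentagonDist x y := by
  simp [chainDist]

/-- Along the edge leaving the `j`-th pentagon, the distance from a vertex of a pentagon up to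
the `j`-th grows by one. -/
theorem chainDist_link_of_le (a : ℕ → Fin 5) {i j : ℕ} (h : i ≤ j) (x : Fin 5) :
    chainDist a i x (j + 1) 0 = chainDist a i x j (a (j + 1)) + 1 := by
  rw [chainDist_of_lt a (by omega)]
  rcases h.eq_or_lt with rfl | h
  · rw [chainDist_self, gapDist_succ_self, pentagonDist_self]
  · rw [chainDist_of_lt a h, gapDist_succ_right a h, pentagonDist_self]
    ring

/-- Along the edge leaving the `j`-th pentagon, the distance from a vertex of a later pentagon
drops by one. -/
theorem chainDist_link_of_lt (a : ℕ → Fin 5) {i j : ℕ} (h : j < i) (x : Fin 5) :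
    chainDist a i x j (a (j + 1)) = chainDist a i x (j + 1) 0 + 1 := by
  rw [chainDist_of_gt a h]
  rcases (show j + 1 ≤ i from h).eq_or_lt with rfl | h
  · rw [chainDist_self, gapDist_succ_self, pentagonDist_self, pentagonDist_comm]
  · rw [chainDist_of_gt a h, gapDist_succ_left a h, pentagonDist_self,
      pentagonDist_comm _ 0]
    ring

theorem PG_dist (n : ℕ) (a : ℕ → Fin 5) (v w : Fin n × Fin 5) :
    (PG n a).dist v w = chainDist a v.1 v.2 w.1 w.2 := by
  obtain ⟨i, x⟩ := v
  refine SimpleGraph.dist_eq_of_potential (PG n a) (i, x)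
    (fun w => chainDist a i x w.1 w.2) ?_ ?_ ?_ w
  · simp [chainDist_self, pentagonDist_self]
  · rintro ⟨j, y⟩ ⟨k, z⟩ (⟨h, hyz⟩ | h | h)
    · obtain rfl : j = k := h
      change (SimpleGraph.cycleGraph 5).Adj y z at hyz
      simp only [chainDist]
      split_ifs
      · have := pentagonDist_le_of_adj 0 _ _ hyz
        omega
      · have := pentagonDist_le_of_adj (a (j + 1)) _ _ hyz
        omega
      · exact pentagonDist_le_of_adj _ _ _ hyz
    all_goals
      simp only [PGLink] at h
      obtain ⟨h, rfl, rfl⟩ := h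
      simp only [← h]
    · rcases le_or_gt (i : ℕ) j with hij | hij
      · have := chainDist_link_of_le a hij x
        omega
      · have := chainDist_link_of_lt a hij x
        omega
    · rcases le_or_gt (i : ℕ) k with hij | hij
      · have := chainDist_link_of_le a hij x
        omega
      · have := chainDist_link_of_lt a hij x
        omega
  -- The neighbour nearer to `(i, x)`: move inside pentagon `j` towards the vertex linked in the
  -- direction of `i` (towards `x` if `j = i`), and cross the link once there.
  · rintro ⟨j, y⟩ hne
    rcases lt_trichotomy (i : ℕ) j with h | h | h
    · by_cases hy : y = 0
      · obtain ⟨k, hk⟩ : ∃ k, (j : ℕ) = k + 1 := ⟨j - 1, by omega⟩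
        refine ⟨(⟨k, by omega⟩, a (k + 1)), Or.inr (Or.inr ⟨hk.symm, by simp [hk], hy⟩), ?_⟩
        simp only [hk, hy]
        exact (chainDist_link_of_le a (by omega) x).symm
      · obtain ⟨z, hz, hz'⟩ := exists_adj_pentagonDist 0 y hy
        refine ⟨(j, z), Or.inl ⟨rfl, hz⟩, ?_⟩
        simp only [chainDist_of_lt a h]
        omega
    · obtain rfl : i = j := Fin.ext h
      obtain ⟨z, hz, hz'⟩ := exists_adj_pentagonDist x y (by rintro rfl; exact hne rfl)
      refine ⟨(i, z), Or.inl ⟨rfl, hz⟩, ?_⟩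
      simpa only [chainDist_self] using hz'
    · by_cases hy : y = a (j + 1)
      · refine ⟨(⟨j + 1, by omega⟩, 0), Or.inr (Or.inl ⟨rfl, hy, rfl⟩), ?_⟩
        simp only [hy]
        exact (chainDist_link_of_lt a h x).symm
      · obtain ⟨z, hz, hz'⟩ := exists_adj_pentagonDist (a (j + 1)) y hy
        refine ⟨(j, z), Or.inl ⟨rfl, hz⟩, ?_⟩
        simp only [chainDist_of_gt a h]
        omega

/-! ### Degrees -/

theorem sum_ite_cycleGraph_adj : ∀ x : Fin 5,
    ∑ y, (if (SimpleGraph.cycleGraph 5).Adj x y then 1 else 0 : ℕ) = 2 := by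
  decide

theorem PG_degree (n : ℕ) (a : ℕ → Fin 5) (i : Fin n) (x : Fin 5) :
    (PG n a).degree (i, x) = 2 + (if (i : ℕ) + 1 < n ∧ x = a (i + 1) then 1 else 0) +
      (if 0 < (i : ℕ) ∧ x = 0 then 1 else 0) := by
  -- The three kinds of adjacency exclude each other, so the indicators add.
  have key : ∀ w : Fin n × Fin 5, (if (PG n a).Adj (i, x) w then 1 else 0 : ℕ) =
      (if i = w.1 then (if (SimpleGraph.cycleGraph 5).Adj x w.2 then 1 else 0) else 0) +
      (if (i : ℕ) + 1 = w.1 ∧ x = a (i + 1) then (if w.2 = 0 then 1 else 0) else 0) +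
      (if (w.1 : ℕ) + 1 = i ∧ x = 0 then (if w.2 = a i then 1 else 0) else 0) := by
    rintro ⟨j, y⟩
    simp only [PG, PGLink, Fin.ext_iff (n := n)]
    rcases lt_trichotomy (i : ℕ) j with h | h | h
    · have h1 : (i : ℕ) ≠ j := by omega
      have h2 : (j : ℕ) + 1 ≠ i := by omega
      by_cases h3 : (i : ℕ) + 1 = j
      · have h4 : (i : ℕ) + 1 + 1 ≠ i := by omega
        simp [← h3, h4, ite_and]
      · simp [h1, h2, h3]
    · have h2 : (j : ℕ) + 1 ≠ i := by omega
      have h3 : (i : ℕ) + 1 ≠ j := by omega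
      simp [h]
    · have h1 : (i : ℕ) ≠ j := by omega
      have h3 : (i : ℕ) + 1 ≠ j := by omega
      by_cases h2 : (j : ℕ) + 1 = i
      · have h4 : (j : ℕ) + 1 + 1 ≠ j := by omega
        simp [← h2, h4, ite_and, and_comm (a := y = _)]
      · simp [h1, h2, h3]
  have s1 : ∀ (c : Fin n → Prop) [DecidablePred c] (f : Fin 5 → ℕ),
      ∑ w : Fin n × Fin 5, (if c w.1 then f w.2 else 0) =
        (∑ j, if c j then 1 else 0) * ∑ y, f y := by
    intro c _ f
    rw [Fintype.sum_prod_type, Finset.sum_mul]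
    refine Finset.sum_congr rfl fun j _ => ?_
    split_ifs <;> simp
  rw [← SimpleGraph.card_neighborFinset_eq_degree, SimpleGraph.neighborFinset_eq_filter,
    Finset.card_filter]
  simp only [key, Finset.sum_add_distrib]
  rw [s1 (fun j => i = j) (fun y => if (SimpleGraph.cycleGraph 5).Adj x y then 1 else 0),
    s1 (fun j => (i : ℕ) + 1 = j ∧ x = a (i + 1)) (fun y => if y = 0 then 1 else 0),
    s1 (fun j => (j : ℕ) + 1 = i ∧ x = 0) (fun y => if y = a i then 1 else 0),
    sum_ite_cycleGraph_adj]
  have e1 : (∑ j : Fin n, if (i : ℕ) + 1 = j ∧ x = a (i + 1) then 1 else 0 : ℕ) =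
      if (i : ℕ) + 1 < n ∧ x = a (i + 1) then 1 else 0 := by
    by_cases h : (i : ℕ) + 1 < n
    · have : ∀ j : Fin n, (i : ℕ) + 1 = j ↔ (⟨i + 1, h⟩ : Fin n) = j := by
        simp [Fin.ext_iff]
      simp [this, h, ite_and]
    · have : ∀ j : Fin n, (i : ℕ) + 1 ≠ j := by omega
      simp [this, h]
  have e2 : (∑ j : Fin n, if (j : ℕ) + 1 = i ∧ x = 0 then 1 else 0 : ℕ) =
      if 0 < (i : ℕ) ∧ x = 0 then 1 else 0 := by
    by_cases h : 0 < (i : ℕ)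
    · have : ∀ j : Fin n, (j : ℕ) + 1 = i ↔ j = (⟨i - 1, by omega⟩ : Fin n) := by
        intro j
        simp only [Fin.ext_iff]
        omega
      simp [this, h, ite_and]
    · have : ∀ j : Fin n, (j : ℕ) + 1 ≠ i := by omega
      simp [this, h]
  rw [e1, e2]
  simp

theorem sum_PG_degree_mul (n : ℕ) (a : ℕ → Fin 5) (i : Fin n) (f : Fin 5 → ℝ) :
    ∑ x, ((PG n a).degree (i, x) : ℝ) * f x = 2 * ∑ x, f x +
      (if (i : ℕ) + 1 < n then 1 else 0) * f (a (i + 1)) +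
      (if 0 < (i : ℕ) then 1 else 0) * f 0 := by
  simp only [PG_degree]
  push_cast
  simp only [add_mul, Finset.sum_add_distrib, ite_and, ← Finset.mul_sum]
  split_ifs <;> simp

/-! ### The Schultz index as an affine function of the inner distances -/

/-- The contribution to the Schultz index of the pairs consisting of a vertex of the `i`-th and a
vertex of the `j`-th pentagon, `i < j`, as a function of the link indicators `L` of `i` and `R` of
`j` and of the distances `l` between the two linked vertices of each pentagon. -/
def blockWeight (l : ℕ → ℝ) (R : ℝ) (i j : ℕ) : ℝ :=
  252 + 6 * (if 0 < i then 1 else 0) + 6 * R + 5 * (if 0 < i then 1 else 0) * l i + 5 * R * l j +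
    5 * (22 + (if 0 < i then 1 else 0) + R) * (1 + ∑ m ∈ Finset.Ico (i + 1) j, (l m + 1))

/-- The distance splits as `P x + E + Q y`, so the double sum reduces to sums over single pentagons:
distances from a vertex sum to 6, and a linked vertex adds one extra term to a degree-weighted sum.
-/
theorem sum_block_of_lt (n : ℕ) (a : ℕ → Fin 5) (i j : Fin n) (hij : i < j) :
    ∑ x, ∑ y, (((PG n a).degree (i, x) : ℝ) + ((PG n a).degree (j, y) : ℝ)) *
      ((PG n a).dist (i, x) (j, y) : ℝ) =
    blockWeight (fun m => (pentagonDist 0 (a (m + 1)) : ℝ))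
      (if (j : ℕ) + 1 < n then 1 else 0) i j := by
  have hij' : (i : ℕ) < j := hij
  have hi : (i : ℕ) + 1 < n := by omega
  have hj : 0 < (j : ℕ) := by omega
  have s6 : ∀ x : Fin 5, ∑ y, (pentagonDist x y : ℝ) = 6 := fun x => by
    exact_mod_cast sum_pentagonDist x
  have s6' : ∀ y : Fin 5, ∑ x, (pentagonDist x y : ℝ) = 6 := fun y => by
    simp only [pentagonDist_comm _ y, s6]
  have hg : (gapDist a i j : ℝ) =
      1 + ∑ m ∈ Finset.Ico ((i : ℕ) + 1) j, ((pentagonDist 0 (a (m + 1)) : ℝ) + 1) := by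
    simp [gapDist]
  have d1 := sum_PG_degree_mul n a i (fun x => (pentagonDist x (a (i + 1)) : ℝ))
  have d2 := sum_PG_degree_mul n a i (fun _ => 1)
  have d3 := sum_PG_degree_mul n a j (fun y => (pentagonDist 0 y : ℝ))
  have d4 := sum_PG_degree_mul n a j (fun _ => 1)
  simp only [s6, s6', pentagonDist_self, mul_one, hi, hj, if_true, Finset.sum_const,
    Finset.card_univ, Fintype.card_fin] at d1 d2 d3 d4
  have expand : ∀ (A B P Q : Fin 5 → ℝ) (E : ℝ), ∑ x, ∑ y, (A x + B y) * (P x + E + Q y) =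
      5 * ∑ x, A x * P x + 5 * E * ∑ x, A x + (∑ x, A x) * ∑ y, Q y +
      (∑ y, B y) * ∑ x, P x + 5 * E * ∑ y, B y + 5 * ∑ y, B y * Q y := by
    intro A B P Q E
    simp only [Fin.sum_univ_five]
    ring
  have e := expand (fun x => ((PG n a).degree (i, x) : ℝ)) (fun y => ((PG n a).degree (j, y) : ℝ))
    (fun x => (pentagonDist x (a (i + 1)) : ℝ)) (fun y => (pentagonDist 0 y : ℝ)) (gapDist a i j)
  simp only [PG_dist, chainDist_of_lt a hij', Nat.cast_add]
  rw [e, d1, d2, d3, d4, s6, s6', hg, blockWeight]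
  simp only [Nat.cast_zero]
  ring

theorem sum_block_self (n : ℕ) (a : ℕ → Fin 5) (i : Fin n) :
    ∑ x, ∑ y, (((PG n a).degree (i, x) : ℝ) + ((PG n a).degree (i, y) : ℝ)) *
      ((PG n a).dist (i, x) (i, y) : ℝ) =
    12 * (10 + (if (i : ℕ) + 1 < n then 1 else 0) + (if 0 < (i : ℕ) then 1 else 0)) := by
  have s6 : ∀ x : Fin 5, ∑ y, (pentagonDist x y : ℝ) = 6 := fun x => by
    exact_mod_cast sum_pentagonDist x
  have s6' : ∀ y : Fin 5, ∑ x, (pentagonDist x y : ℝ) = 6 := fun y => by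
    simp only [pentagonDist_comm _ y, s6]
  have d2 := sum_PG_degree_mul n a i (fun _ => 1)
  simp only [mul_one, Finset.sum_const, Finset.card_univ, Fintype.card_fin] at d2
  simp only [PG_dist, chainDist_self, add_mul, Finset.sum_add_distrib]
  rw [Finset.sum_comm (f := fun x y => ((PG n a).degree (i, y) : ℝ) * (pentagonDist x y : ℝ))]
  simp only [← Finset.mul_sum, s6, s6', ← Finset.sum_mul, d2]
  simp
  ring

theorem Finset.sum_sum_range_of_symm (b : ℕ → ℕ → ℝ) (hb : ∀ i j, b i j = b j i) (n : ℕ) :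
    ∑ i ∈ Finset.range n, ∑ j ∈ Finset.range n, b i j =
      ∑ i ∈ Finset.range n, b i i + 2 * ∑ j ∈ Finset.range n, ∑ i ∈ Finset.range j, b i j := by
  induction n with
  | zero => simp
  | succ n ih =>
    rw [Finset.sum_range_succ]
    simp only [Finset.sum_range_succ _ n, Finset.sum_add_distrib]
    rw [ih]
    simp only [hb n]
    ring

/-- Symmetry cancels the factor one half off the diagonal. The last pentagon is split off because it
alone has no outgoing link. -/
theorem schultzIndex_PG (N : ℕ) (a : ℕ → Fin 5) :
    schultzIndex (PG (N + 1) a) =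
      6 * ∑ i ∈ Finset.range (N + 1),
        (10 + (if i + 1 < N + 1 then 1 else 0) + (if 0 < i then 1 else 0)) +
      (∑ j ∈ Finset.range N, ∑ i ∈ Finset.range j,
        blockWeight (fun m => (pentagonDist 0 (a (m + 1)) : ℝ)) 1 i j +
      ∑ i ∈ Finset.range N, blockWeight (fun m => (pentagonDist 0 (a (m + 1)) : ℝ)) 0 i N) := by
  set l : ℕ → ℝ := fun m => (pentagonDist 0 (a (m + 1)) : ℝ) with hl
  let B : Fin (N + 1) → Fin (N + 1) → ℝ := fun i j => ∑ x, ∑ y,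
    (((PG (N + 1) a).degree (i, x) : ℝ) + ((PG (N + 1) a).degree (j, y) : ℝ)) *
      ((PG (N + 1) a).dist (i, x) (j, y) : ℝ)
  have hBsymm : ∀ i j, B i j = B j i := by
    intro i j
    simp only [B]
    rw [Finset.sum_comm]
    refine Finset.sum_congr rfl fun y _ => Finset.sum_congr rfl fun x _ => ?_
    rw [SimpleGraph.dist_comm, add_comm]
  let R : ℕ → ℝ := fun j => if j + 1 < N + 1 then 1 else 0
  let b : ℕ → ℕ → ℝ := fun i j =>
    if i < j then blockWeight l (R j) i j
    else if j < i then blockWeight l (R i) j i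
    else 12 * (10 + (if i + 1 < N + 1 then 1 else 0) + (if 0 < i then 1 else 0))
  have hb : ∀ i j, b i j = b j i := by
    intro i j
    simp only [b]
    rcases lt_trichotomy i j with h | h | h
    · rw [if_pos h, if_neg (by omega), if_pos h]
    · subst h; rfl
    · rw [if_neg (by omega), if_pos h, if_pos h]
  have hBb : ∀ i j, B i j = b i j := by
    intro i j
    rcases lt_trichotomy i j with h | h | h
    · have h' : (i : ℕ) < j := h
      simp only [b, if_pos h']
      exact sum_block_of_lt _ a i j h
    · subst h
      simp only [b, lt_irrefl, if_false]
      exact sum_block_self _ a i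
    · have h' : (j : ℕ) < i := h
      rw [hBsymm, hb]
      simp only [b, if_pos h']
      exact sum_block_of_lt _ a j i h
  have hS : schultzIndex (PG (N + 1) a) = (1 / 2) * ∑ i, ∑ j, B i j := by
    rw [schultzIndex, Fintype.sum_prod_type]
    congr 1
    refine Finset.sum_congr rfl fun i _ => ?_
    simp only [B, Fintype.sum_prod_type]
    rw [Finset.sum_comm]
  rw [hS]
  simp only [hBb]
  have hrow : ∀ i : Fin (N + 1), ∑ j : Fin (N + 1), b i j = ∑ j ∈ Finset.range (N + 1), b i j :=
    fun i => Fin.sum_univ_eq_sum_range (fun j => b i j) (N + 1)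
  simp only [hrow]
  rw [Fin.sum_univ_eq_sum_range (fun i => ∑ j ∈ Finset.range (N + 1), b i j),
    Finset.sum_sum_range_of_symm b hb]
  have h1 : ∀ i, b i i = 12 * (10 + (if i + 1 < N + 1 then 1 else 0) + (if 0 < i then 1 else 0)) := by
    intro i
    simp only [b, lt_irrefl, if_false]
  have h2 : ∀ j, ∑ i ∈ Finset.range j, b i j = ∑ i ∈ Finset.range j, blockWeight l (R j) i j := by
    intro j
    refine Finset.sum_congr rfl fun i hi => ?_
    simp only [b, if_pos (Finset.mem_range.1 hi)]
  simp only [h1, h2]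
  rw [← Finset.mul_sum, Finset.sum_range_succ (fun j => ∑ i ∈ Finset.range j, _)]
  have h3 : R N = 0 := by simp [R]
  have h4 : ∑ j ∈ Finset.range N, ∑ i ∈ Finset.range j, blockWeight l (R j) i j =
      ∑ j ∈ Finset.range N, ∑ i ∈ Finset.range j, blockWeight l 1 i j := by
    refine Finset.sum_congr rfl fun j hj => ?_
    have : R j = 1 := by
      simp only [R]
      rw [if_pos (by have := Finset.mem_range.1 hj; omega)]
    rw [this]
  rw [h3, h4]
  ring

/-- Each `l m` lies on the paths from the `m` pentagons before it, whence `m * l m`. The case `j =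
0` is separate because the corrections for `i = 0` presuppose such an `i`. -/
theorem sum_blockWeight (l : ℕ → ℝ) (R : ℝ) (j : ℕ) :
    ∑ i ∈ Finset.range j, blockWeight l R i j =
      (if j = 0 then 0 else j * (252 + 6 * R) + 6 * (j - 1 : ℝ) +
        5 * (23 + R) * (j * (j + 1) / 2) - 5 * j) +
      5 * R * j * l j + 5 * (23 + R) * ∑ m ∈ Finset.range j, (m : ℝ) * l m := by
  rcases j with _ | j
  · simp
  have hgap : ∀ j : ℕ, ∑ i ∈ Finset.range (j + 1),
      (1 + ∑ m ∈ Finset.Ico (i + 1) (j + 1), (l m + 1)) =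
      ((j + 1 : ℕ) : ℝ) * (j + 2) / 2 + ∑ m ∈ Finset.range (j + 1), (m : ℝ) * l m := by
    intro j
    induction j with
    | zero => simp
    | succ j ih =>
      rw [Finset.sum_range_succ, Finset.sum_range_succ (fun m => (m : ℝ) * l m)]
      have : ∀ i ∈ Finset.range (j + 1), 1 + ∑ m ∈ Finset.Ico (i + 1) (j + 1 + 1), (l m + 1) =
          (1 + ∑ m ∈ Finset.Ico (i + 1) (j + 1), (l m + 1)) + (l (j + 1) + 1) := by
        intro i hi
        rw [Finset.sum_Ico_succ_top (by have := Finset.mem_range.1 hi; omega), add_assoc]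
      rw [Finset.sum_congr rfl this, Finset.sum_add_distrib, ih]
      simp
      ring
  have hsplit : ∀ (f : ℕ → ℝ), ∑ i ∈ Finset.range (j + 1), (if 0 < i then 1 else 0) * f i =
      ∑ i ∈ Finset.range (j + 1), f i - f 0 := by
    intro f
    rw [Finset.sum_range_succ', Finset.sum_range_succ']
    simp
  have hIco : ∑ m ∈ Finset.Ico (0 + 1) (j + 1), (l m + 1) =
      ∑ m ∈ Finset.range (j + 1), l m - l 0 + j := by
    rw [Finset.sum_add_distrib, Finset.sum_Ico_eq_sub _ (by omega)]
    simp
  set L : ℕ → ℝ := fun i => if 0 < i then 1 else 0 with hL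
  set E : ℕ → ℝ := fun i => 1 + ∑ m ∈ Finset.Ico (i + 1) (j + 1), (l m + 1) with hE
  have hW : ∀ i, blockWeight l R i (j + 1) = (252 + 6 * R + 5 * R * l (j + 1)) + 6 * (L i * 1) +
      5 * (L i * l i) + 5 * (22 + R) * E i + 5 * (L i * E i) := by
    intro i
    simp only [blockWeight, hL, hE]
    ring
  simp only [hW, Finset.sum_add_distrib, ← Finset.mul_sum]
  rw [hsplit (fun _ => 1), hsplit l, hsplit E, hgap]
  -- The unweighted sum of the `l m` in `E 0` cancels the one coming from the terms `L i * l i`.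
  have hE0 : E 0 = 1 + (∑ m ∈ Finset.range (j + 1), l m - l 0 + j) := by
    rw [← hIco]
  rw [hE0]
  simp
  ring

/-- The Schultz index of a pentagonal chain is an affine function of the distances between the two
linked vertices of its inner pentagons. -/
theorem exists_schultzIndex_PG_eq (N : ℕ) : ∃ C : ℝ, ∀ a : ℕ → Fin 5,
    schultzIndex (PG (N + 1) a) =
      C + 120 * ∑ m ∈ Finset.range N, m * (N - m : ℝ) * (pentagonDist 0 (a (m + 1)) : ℝ) := by
  simp only [schultzIndex_PG, sum_blockWeight]
  -- Exchanging the sums counts `m` once for each `j` with `m < j < N`; the endpoint term 5 raises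
  -- 115 to 120 for the last column.
  have hsum : ∀ l : ℕ → ℝ, ∑ j ∈ Finset.range N, (5 * 1 * (j : ℝ) * l j +
      5 * (23 + 1) * ∑ m ∈ Finset.range j, (m : ℝ) * l m) +
      5 * (23 + 0) * ∑ m ∈ Finset.range N, (m : ℝ) * l m =
      120 * ∑ m ∈ Finset.range N, m * (N - m : ℝ) * l m := by
    intro l
    induction N with
    | zero => simp
    | succ N ih =>
      have e : ∑ m ∈ Finset.range (N + 1), (m : ℝ) * (((N + 1 : ℕ) : ℝ) - m) * l m =
          ∑ m ∈ Finset.range (N + 1), (m : ℝ) * ((N : ℝ) - m) * l m +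
            ∑ m ∈ Finset.range (N + 1), (m : ℝ) * l m := by
        rw [← Finset.sum_add_distrib]
        refine Finset.sum_congr rfl fun m _ => ?_
        push_cast
        ring
      rw [e, Finset.sum_range_succ (fun m : ℕ => (m : ℝ) * ((N : ℝ) - m) * l m), Finset.sum_range_succ,
        Finset.sum_range_succ (fun m : ℕ => (m : ℝ) * l m)]
      linear_combination ih
  set q : ℕ → ℝ → ℝ := fun j R => if j = 0 then 0 else j * (252 + 6 * R) + 6 * (j - 1 : ℝ) +
    5 * (23 + R) * (j * (j + 1) / 2) - 5 * j
  refine ⟨6 * ∑ i ∈ Finset.range (N + 1),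
      (10 + (if i + 1 < N + 1 then 1 else 0) + (if 0 < i then 1 else 0)) +
      (∑ j ∈ Finset.range N, q j 1 + q N 0), fun a => ?_⟩
  rw [← hsum]
  simp only [Finset.sum_add_distrib]
  ring

/-! ### Uniform convergence of distribution functions -/

/-- **Pólya's theorem**: pointwise convergence of monotone functions to a continuous function with
limits `0` and `1` at infinity is uniform, if their values lie in `[0, 1]`. -/
theorem tendsto_iSup_abs_sub_of_monotone {F : ℕ → ℝ → ℝ} {G : ℝ → ℝ} (hF : ∀ n, Monotone (F n))
    (hF0 : ∀ n a, 0 ≤ F n a) (hF1 : ∀ n a, F n a ≤ 1) (hG : Continuous G) (hGm : Monotone G)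
    (hbot : Tendsto G atBot (𝓝 0)) (htop : Tendsto G atTop (𝓝 1))
    (hlim : ∀ a, Tendsto (fun n => F n a) atTop (𝓝 (G a))) :
    Tendsto (fun n => ⨆ a, |F n a - G a|) atTop (𝓝 0) := by
  have hG0 : ∀ a, 0 ≤ G a := fun a => ge_of_tendsto' (hlim a) fun n => hF0 n a
  have hG1 : ∀ a, G a ≤ 1 := fun a => le_of_tendsto' (hlim a) fun n => hF1 n a
  have key : ∀ ε > 0, ∀ᶠ n in atTop, ∀ a, |F n a - G a| ≤ 2 * ε := by
    intro ε hε
    have hnear : ∀ a, ∀ᶠ n in atTop, |F n a - G a| < ε := by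
      intro a
      have := Metric.tendsto_nhds.1 (hlim a) ε hε
      simpa [Real.dist_eq] using this
    obtain ⟨A, hA⟩ := (hbot.eventually (gt_mem_nhds hε)).exists
    obtain ⟨B, hB⟩ := (htop.eventually (lt_mem_nhds (show 1 - ε < 1 by linarith))).exists
    have hmid : ∀ᶠ n in atTop, ∀ a ∈ Set.Icc A B, |F n a - G a| ≤ 2 * ε := by
      refine isCompact_Icc.induction_on (p := fun s => ∀ᶠ n in atTop, ∀ a ∈ s,
        |F n a - G a| ≤ 2 * ε) (by simp) (fun s t hst h => ?_) (fun s t hs ht => ?_) ?_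
      · filter_upwards [h] with n hn a ha using hn a (hst ha)
      · filter_upwards [hs, ht] with n hn hn' a ha using ha.elim (hn a) (hn' a)
      -- On a short interval `G` varies by less than `ε`, and monotonicity traps `F n` between its
      -- values at the endpoints.
      · intro x _
        have hc := Metric.continuous_iff.1 hG x (ε / 2) (by linarith)
        obtain ⟨δ, hδ, hc⟩ := hc
        have h1 := hc (x - δ / 2) (by rw [Real.dist_eq, abs_lt]; constructor <;> linarith)
        have h2 := hc (x + δ / 2) (by rw [Real.dist_eq, abs_lt]; constructor <;> linarith)
        rw [Real.dist_eq, abs_lt] at h1 h2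
        refine ⟨Set.Icc (x - δ / 2) (x + δ / 2),
          mem_nhdsWithin_of_mem_nhds (Icc_mem_nhds (by linarith) (by linarith)), ?_⟩
        filter_upwards [hnear (x - δ / 2), hnear (x + δ / 2)] with n h3 h4 a ha
        rw [abs_lt] at h3 h4
        have := hF n ha.1
        have := hF n ha.2
        have := hGm ha.1
        have := hGm ha.2
        rw [abs_le]
        constructor <;> linarith
    filter_upwards [hmid, hnear A, hnear B] with n hn hnA hnB a
    rw [abs_lt] at hnA hnB
    have := hF0 n a
    have := hF1 n a
    have := hG0 a
    have := hG1 a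
    rcases lt_or_ge a A with h | h
    · have := hF n h.le
      have := hGm h.le
      rw [abs_le]
      constructor <;> linarith
    · rcases lt_or_ge B a with h' | h'
      · have := hF n h'.le
        have := hGm h'.le
        rw [abs_le]
        constructor <;> linarith
      · exact hn a ⟨h, h'⟩
  rw [Metric.tendsto_nhds]
  intro ε hε
  filter_upwards [key (ε / 4) (by linarith)] with n hn
  rw [Real.dist_eq, sub_zero, abs_of_nonneg (Real.iSup_nonneg fun a => abs_nonneg _)]
  have := Real.iSup_le hn (by linarith)
  linarith

/-! ### The central limit theorem for weighted sums -/

/-- Replace the factors one at a time; the remaining ones have norm at most 1. -/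
theorem norm_prod_sub_prod_le {ι R : Type*} [NormedCommRing R] [NormOneClass R] (s : Finset ι)
    (f g : ι → R) (hf : ∀ i ∈ s, ‖f i‖ ≤ 1) (hg : ∀ i ∈ s, ‖g i‖ ≤ 1) :
    ‖∏ i ∈ s, f i - ∏ i ∈ s, g i‖ ≤ ∑ i ∈ s, ‖f i - g i‖ := by
  classical
  induction s using Finset.induction_on with
  | empty => simp
  | insert i s hi ih =>
    rw [Finset.prod_insert hi, Finset.prod_insert hi, Finset.sum_insert hi]
    have ih := ih (fun j hj => hf j (Finset.mem_insert_of_mem hj))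
      (fun j hj => hg j (Finset.mem_insert_of_mem hj))
    have hP : ‖∏ j ∈ s, f j‖ ≤ 1 := (Finset.norm_prod_le s f).trans
      (Finset.prod_le_one (fun _ _ => norm_nonneg _)
        fun j hj => hf j (Finset.mem_insert_of_mem hj))
    calc ‖f i * ∏ j ∈ s, f j - g i * ∏ j ∈ s, g j‖
        = ‖(f i - g i) * ∏ j ∈ s, f j + g i * (∏ j ∈ s, f j - ∏ j ∈ s, g j)‖ := by
          congr 1; ring
      _ ≤ ‖f i - g i‖ * ‖∏ j ∈ s, f j‖ + ‖g i‖ * ‖∏ j ∈ s, f j - ∏ j ∈ s, g j‖ :=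
          (norm_add_le _ _).trans (add_le_add (norm_mul_le _ _) (norm_mul_le _ _))
      _ ≤ ‖f i - g i‖ * 1 + 1 * ∑ j ∈ s, ‖f j - g j‖ := by
          gcongr
          exact hg i (Finset.mem_insert_self _ _)
      _ = _ := by ring

/-- This is the second-order expansion of a characteristic function, applied to the Gaussian itself.
-/
theorem isLittleO_cexp_sub_one_sub :
    (fun t : ℝ => Complex.exp (-(t : ℂ) ^ 2 / 2) - (1 - (t : ℂ) ^ 2 / 2)) =o[𝓝 0]
      fun t : ℝ => t ^ 2 := by
  have h := charFun_gaussianReal (μ := 0) (v := 1)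
  have h2 := taylor_charFun_two (P := gaussianReal 0 1) (X := id) aemeasurable_id
    (by simp) (by
      have := variance_id_gaussianReal (μ := 0) (v := 1)
      rw [variance_eq_integral aemeasurable_id] at this
      simpa using this)
  simp only [Measure.map_id, h] at h2
  convert h2 using 4
  simp [neg_div]

/-- A central limit theorem for weighted sums: if the squares of the weights sum up to one and the
weights are uniformly small, then the characteristic functions converge to the Gaussian one. -/
theorem tendsto_charFun_weighted_sum {Ω : Type*} [MeasurableSpace Ω] {P : Measure Ω}
    [IsProbabilityMeasure P] {X : ℕ → Ω → ℝ} (hX : ∀ k, Measurable (X k)) (hindep : iIndepFun X P)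
    (hchar : ∀ k, charFun (P.map (X k)) = charFun (P.map (X 0)))
    (h0 : P[X 0] = 0) (h1 : P[X 0 ^ 2] = 1) (c : ℕ → ℕ → ℝ) (s : ℕ → ℕ)
    (hc : ∀ n, ∑ k ∈ Finset.range (s n), c n k ^ 2 = 1)
    (hsmall : ∀ ε > 0, ∀ᶠ n in atTop, ∀ k ∈ Finset.range (s n), |c n k| < ε) (t : ℝ) :
    Tendsto (fun n => charFun (P.map fun ω => ∑ k ∈ Finset.range (s n), c n k * X k ω) t) atTop
      (𝓝 (charFun (gaussianReal 0 1) t)) := by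
  set φ := charFun (P.map (X 0)) with hφ
  have hprob : IsProbabilityMeasure (P.map (X 0)) :=
    Measure.isProbabilityMeasure_map (hX 0).aemeasurable
  have hprod : ∀ n, charFun (P.map fun ω => ∑ k ∈ Finset.range (s n), c n k * X k ω) t =
      ∏ k ∈ Finset.range (s n), φ (c n k * t) := by
    intro n
    have hi : iIndepFun (fun k ω => c n k * X k ω) P :=
      hindep.comp (fun k x => c n k * x) (fun k => by fun_prop)
    rw [(hi.restrict _).charFun_map_fun_finsetSum_eq_prod
      (fun k _ => ((hX k).const_mul _).aemeasurable), Finset.prod_apply]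
    refine Finset.prod_congr rfl fun k _ => ?_
    rw [charFun_map_mul_comp, hchar]
    exact (hX k).aemeasurable
  -- As the squared weights sum to one, the Gaussian factors along the same weights and can be
  -- compared factor by factor.
  have hgauss : ∀ n, charFun (gaussianReal 0 1) t =
      ∏ k ∈ Finset.range (s n), Complex.exp (-((c n k * t : ℝ) : ℂ) ^ 2 / 2) := by
    intro n
    rw [charFun_gaussianReal, ← Complex.exp_sum]
    congr 1
    have : ∀ k, -((c n k * t : ℝ) : ℂ) ^ 2 / 2 = ((c n k ^ 2 : ℝ) : ℂ) * (-(t : ℂ) ^ 2 / 2) := by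
      intro k; push_cast; ring
    simp only [this]
    rw [← Finset.sum_mul, ← Complex.ofReal_sum, hc]
    simp [neg_div]
  have hlit : (fun x : ℝ => φ x - Complex.exp (-(x : ℂ) ^ 2 / 2)) =o[𝓝 0] fun x : ℝ => x ^ 2 := by
    have := (taylor_charFun_two (hX 0).aemeasurable h0 h1).sub isLittleO_cexp_sub_one_sub
    simpa using this
  rw [Metric.tendsto_nhds]
  intro ε hε
  set η : ℝ := ε / (2 * (t ^ 2 + 1)) with hη
  have hηpos : 0 < η := by positivity
  obtain ⟨δ, hδ, hball⟩ := Metric.eventually_nhds_iff.1 (hlit.def hηpos)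
  filter_upwards [hsmall (δ / (|t| + 1)) (by positivity)] with n hn
  rw [dist_eq_norm, hprod, hgauss n]
  have hexp : ∀ x : ℝ, ‖Complex.exp (-(x : ℂ) ^ 2 / 2)‖ ≤ 1 := by
    intro x
    have : -(x : ℂ) ^ 2 / 2 = ((-x ^ 2 / 2 : ℝ) : ℂ) := by push_cast; ring
    rw [this, Complex.norm_exp_ofReal]
    exact Real.exp_le_one_iff.2 (by nlinarith [sq_nonneg x])
  calc _ ≤ ∑ k ∈ Finset.range (s n), ‖φ (c n k * t) - Complex.exp (-((c n k * t : ℝ) : ℂ) ^ 2 / 2)‖ :=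
        norm_prod_sub_prod_le _ _ _ (fun _ _ => norm_charFun_le_one _) (fun _ _ => hexp _)
    _ ≤ ∑ k ∈ Finset.range (s n), η * (c n k ^ 2 * t ^ 2) := by
        refine Finset.sum_le_sum fun k hk => ?_
        have hlt : |c n k * t| < δ := by
          have h3 := hn k hk
          rw [lt_div_iff₀ (by positivity)] at h3
          rw [abs_mul]
          nlinarith [abs_nonneg (c n k), abs_nonneg t]
        have := hball (y := c n k * t) (by simpa [Real.dist_eq] using hlt)
        rw [Real.norm_eq_abs, abs_of_nonneg (sq_nonneg _), mul_pow] at this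
        exact this
    _ = η * t ^ 2 := by
        rw [← Finset.mul_sum, ← Finset.sum_mul, hc, one_mul]
    _ < ε := by
        rw [hη, div_mul_eq_mul_div, div_lt_iff₀ (by positivity)]
        nlinarith [sq_nonneg t]

theorem gaussianReal_real_Iic (a : ℝ) : (gaussianReal 0 1).real (Set.Iic a) =
    ∫ t in Set.Iic a, 1 / Real.sqrt (2 * Real.pi) * Real.exp (-t ^ 2 / 2) := by
  rw [measureReal_def, gaussianReal_apply_eq_integral 0 one_ne_zero, ENNReal.toReal_ofReal
    (integral_nonneg fun x => gaussianPDFReal_nonneg _ _ _)]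
  simp [gaussianPDFReal]

/-- The jump of the distribution function at a point is the mass of that point. -/
theorem continuous_cdf (ν : Measure ℝ) [IsProbabilityMeasure ν] [NullSingletonClass ν] :
    Continuous (cdf ν) := by
  refine continuous_iff_continuousAt.2 fun a => ?_
  rw [(monotone_cdf ν).continuousAt_iff_leftLim_eq_rightLim, StieltjesFunction.rightLim_eq]
  have h := (cdf ν).measure_singleton a
  rw [measure_cdf, measure_singleton, eq_comm, ENNReal.ofReal_eq_zero] at h
  exact le_antisymm ((monotone_cdf ν).leftLim_le le_rfl) (by linarith)

/-- Convergence of characteristic functions to the standard Gaussian one gives uniform convergence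
of the distribution functions. -/
theorem tendsto_iSup_abs_sub_gaussian {Ω : Type*} [MeasurableSpace Ω] {P : Measure Ω}
    [IsProbabilityMeasure P] {Y : ℕ → Ω → ℝ} (hY : ∀ n, Measurable (Y n))
    (h : ∀ t, Tendsto (fun n => charFun (P.map (Y n)) t) atTop
      (𝓝 (charFun (gaussianReal 0 1) t))) :
    Tendsto (fun n => ⨆ a : ℝ, |P.real {ω | Y n ω ≤ a} -
      ∫ t in Set.Iic a, 1 / Real.sqrt (2 * Real.pi) * Real.exp (-t ^ 2 / 2)|) atTop (𝓝 0) := by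
  simp only [← gaussianReal_real_Iic]
  have hna : NullSingletonClass (gaussianReal 0 1) := nullSingletonClass_gaussianReal one_ne_zero
  let ν : ℕ → ProbabilityMeasure ℝ := fun n =>
    ⟨P.map (Y n), Measure.isProbabilityMeasure_map (hY n).aemeasurable⟩
  have hν : Tendsto ν atTop (𝓝 ⟨gaussianReal 0 1, inferInstance⟩) :=
    ProbabilityMeasure.tendsto_iff_tendsto_charFun.2 h
  have hcdf : (fun a => (gaussianReal 0 1).real (Set.Iic a)) = cdf (gaussianReal 0 1) := by
    ext a; rw [cdf_eq_real]
  have hmap : ∀ n a, P.real {ω | Y n ω ≤ a} = (P.map (Y n)).real (Set.Iic a) := by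
    intro n a
    rw [map_measureReal_apply (hY n) measurableSet_Iic]
    rfl
  refine tendsto_iSup_abs_sub_of_monotone (F := fun n a => P.real {ω | Y n ω ≤ a})
    (G := fun a => (gaussianReal 0 1).real (Set.Iic a)) ?_ ?_ ?_ ?_ ?_ ?_ ?_ ?_
  · intro n a b hab
    exact measureReal_mono fun ω (hω : Y n ω ≤ a) => hω.trans hab
  · exact fun _ _ => measureReal_nonneg
  · exact fun _ _ => measureReal_le_one
  · rw [hcdf]; exact continuous_cdf _
  · rw [hcdf]; exact monotone_cdf _
  · rw [hcdf]; exact tendsto_cdf_atBot _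
  · rw [hcdf]; exact tendsto_cdf_atTop _
  · intro a
    have := ProbabilityMeasure.tendsto_measure_of_null_frontier_of_tendsto hν (E := Set.Iic a)
      (by rw [frontier_Iic]; ext; simp)
    simp only [hmap]
    exact (NNReal.tendsto_coe.2 this)

/-! ### Bernoulli variables -/

section Bernoulli

variable {Ω : Type*} [MeasurableSpace Ω] {P : Measure Ω} {Z : Ω → ℝ} {p : ℝ}

theorem memLp_of_zero_or_one [IsFiniteMeasure P] (hZ : Measurable Z) (h01 : ∀ ω, Z ω = 0 ∨ Z ω = 1)
    (q : ENNReal) : MemLp Z q P := by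
  refine MemLp.of_bound hZ.aestronglyMeasurable 1 (ae_of_all _ fun ω => ?_)
  rcases h01 ω with h | h <;> simp [h]

theorem integral_of_zero_or_one (hZ : Measurable Z) (h01 : ∀ ω, Z ω = 0 ∨ Z ω = 1)
    (hp : P.real {ω | Z ω = 1} = p) : ∫ ω, Z ω ∂P = p := by
  have h : Z = {ω | Z ω = 1}.indicator 1 := by
    ext ω
    rcases h01 ω with h | h <;> simp [Set.indicator, h]
  conv_lhs => rw [h]
  rw [← hp]
  exact integral_indicator_one (hZ (measurableSet_singleton 1))

/-- Every function is affine on `{0, 1}`. Vector values make this cover complex exponentials. -/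
theorem integral_comp_of_zero_or_one [IsProbabilityMeasure P] {E : Type*} [NormedAddCommGroup E] [NormedSpace ℝ E]
    [CompleteSpace E] (hZ : Measurable Z) (h01 : ∀ ω, Z ω = 0 ∨ Z ω = 1)
    (hp : P.real {ω | Z ω = 1} = p) (f : ℝ → E) :
    ∫ ω, f (Z ω) ∂P = f 0 + p • (f 1 - f 0) := by
  have h : ∀ ω, f (Z ω) = f 0 + Z ω • (f 1 - f 0) := by
    intro ω
    rcases h01 ω with h | h <;> simp [h]
  have hint : Integrable Z P := memLp_one_iff_integrable.1 (memLp_of_zero_or_one hZ h01 1)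
  simp only [h]
  rw [integral_add (integrable_const _) (hint.smul_const _), integral_smul_const,
    integral_of_zero_or_one hZ h01 hp]
  simp

theorem variance_of_zero_or_one [IsProbabilityMeasure P] (hZ : Measurable Z) (h01 : ∀ ω, Z ω = 0 ∨ Z ω = 1)
    (hp : P.real {ω | Z ω = 1} = p) : Var[Z; P] = p * (1 - p) := by
  rw [variance_eq_integral hZ.aemeasurable, integral_of_zero_or_one hZ h01 hp,
    integral_comp_of_zero_or_one hZ h01 hp fun x => (x - p) ^ 2]
  simp only [smul_eq_mul]
  ring

end Bernoulli

/-! ### The weights -/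

theorem sum_sq_succ_mul_sub (K : ℕ) :
    ∑ k ∈ Finset.range K, ((k + 1 : ℝ) * (K - k)) ^ 2 = (K + 1 : ℝ) * ((K + 1) ^ 4 - 1) / 30 := by
  -- The parameter `x` is freed from the length of the sum so that induction applies.
  have h : ∀ (x : ℝ) (n : ℕ), ∑ k ∈ Finset.range n, ((k + 1 : ℝ) * (x - k)) ^ 2 =
      (x + 1) ^ 2 * (n * (n + 1) * (2 * n + 1) / 6) - 2 * (x + 1) * (n * (n + 1) / 2) ^ 2 +
        n * (n + 1) * (2 * n + 1) * (3 * n ^ 2 + 3 * n - 1) / 30 := by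
    intro x n
    induction n with
    | zero => simp
    | succ n ih =>
      rw [Finset.sum_range_succ, ih]
      push_cast
      ring
  rw [h]
  ring

theorem sum_sq_pos (K : ℕ) :
    0 < ∑ k ∈ Finset.range (K + 1), ((k + 1 : ℝ) * ((K + 1 : ℕ) - k)) ^ 2 := by
  refine Finset.sum_pos (fun k hk => ?_) (by simp)
  have : (k : ℝ) < ((K + 1 : ℕ) : ℝ) := by exact_mod_cast Finset.mem_range.1 hk
  have : 0 < ((K + 1 : ℕ) : ℝ) - k := by linarith
  positivity

/-- The normalised weights `(k + 1) (K + 1 - k)`, `k ≤ K`, are uniformly small for large `K`. -/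
theorem eventually_abs_weight_lt (ε : ℝ) (hε : 0 < ε) : ∀ᶠ K : ℕ in atTop,
    ∀ k ∈ Finset.range (K + 1), |(k + 1 : ℝ) * ((K + 1 : ℕ) - k) /
      Real.sqrt (∑ k ∈ Finset.range (K + 1), ((k + 1 : ℝ) * ((K + 1 : ℕ) - k)) ^ 2)| < ε := by
  -- With `x = K + 2`, the squared normalised weight is at most `30 x⁴ / (x (x⁴ - 1)) ≤ 60 / x`.
  filter_upwards [tendsto_natCast_atTop_atTop.eventually_gt_atTop (60 / ε ^ 2)] with K hK k hk
  have hk' : (k : ℝ) < ((K + 1 : ℕ) : ℝ) := by exact_mod_cast Finset.mem_range.1 hk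
  push_cast at hk'
  have hk0 : (0 : ℝ) ≤ k := by positivity
  refine abs_lt_of_sq_lt_sq ?_ hε.le
  rw [div_pow, Real.sq_sqrt (sum_sq_pos K).le, div_lt_iff₀ (sum_sq_pos K), sum_sq_succ_mul_sub]
  push_cast
  rw [div_lt_iff₀ (by positivity)] at hK
  set x : ℝ := (K : ℝ) + 1 + 1 with hx
  have hx2 : 2 ≤ x := by
    have : (0 : ℝ) ≤ K := by positivity
    linarith
  have h1 : ((k + 1 : ℝ) * (K + 1 - k)) ^ 2 ≤ (x * x) ^ 2 := by
    have : 0 < (K + 1 - k : ℝ) := by linarith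
    gcongr
    · linarith
    · linarith
  have h2 : 60 < x * ε ^ 2 := by nlinarith [sq_nonneg ε]
  have h3 : x ^ 4 ≤ 2 * (x ^ 4 - 1) := by
    have : (2 : ℝ) ^ 4 ≤ x ^ 4 := by gcongr
    linarith
  have h4 : 0 < x ^ 4 - 1 := by
    have : (2 : ℝ) ^ 4 ≤ x ^ 4 := by gcongr
    linarith
  nlinarith

/-! ### The index of the random chain -/

theorem pentagonDist_zero_eq : ∀ x : Fin 5, x ≠ 0 →
    pentagonDist 0 x = 1 + if x = 2 ∨ x = 3 then 1 else 0 := by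
  decide

section Chain

variable {Ω : Type*} {u : ℕ → Ω → Fin 5}

theorem choiceTwo_zero_or_one (n : ℕ) (ω : Ω) : choiceTwo u n ω = 0 ∨ choiceTwo u n ω = 1 := by
  rw [choiceTwo]
  split_ifs <;> simp

theorem choiceOne_eq_one_sub {n : ℕ} {ω : Ω} (h : u n ω ≠ 0) :
    choiceOne u n ω = 1 - choiceTwo u n ω := by
  rw [choiceOne, choiceTwo]
  generalize u n ω = x at h
  fin_cases x <;> simp_all

theorem measurable_choiceTwo [MeasurableSpace Ω] {n : ℕ} (h : Measurable (u n)) :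
    Measurable (choiceTwo u n) := by
  have : choiceTwo u n = (fun x : Fin 5 => if x = 2 ∨ x = 3 then (1 : ℝ) else 0) ∘ u n := rfl
  rw [this]
  exact (measurable_of_finite _).comp h

theorem exists_schultzPG_one_eq (u : ℕ → Ω → Fin 5) : ∃ C : ℝ, ∀ ω, schultzPG u 1 ω = C := by
  obtain ⟨C, hC⟩ := exists_schultzIndex_PG_eq 0
  exact ⟨C, fun ω => by simpa [schultzPG] using hC fun k => u k ω⟩

theorem exists_schultzPG_eq (hu : ∀ n, 2 ≤ n → ∀ ω, u n ω ≠ 0) (K : ℕ) : ∃ C : ℝ, ∀ ω,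
    schultzPG u (K + 2) ω =
      C + 120 * ∑ k ∈ Finset.range K, ((k + 1 : ℝ) * (K - k)) * choiceTwo u (k + 2) ω := by
  obtain ⟨C, hC⟩ := exists_schultzIndex_PG_eq (K + 1)
  refine ⟨C + 120 * ∑ k ∈ Finset.range K, ((k + 1 : ℝ) * (K - k)), fun ω => ?_⟩
  -- The term `m = 0` has weight zero, so the arbitrary vertex `u₁` plays no role; then `m = k + 1`.
  rw [schultzPG, hC, Finset.sum_range_succ', add_assoc, ← mul_add, ← Finset.sum_add_distrib]
  congr 2
  simp only [Nat.cast_zero, zero_mul, add_zero]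
  refine Finset.sum_congr rfl fun k _ => ?_
  rw [pentagonDist_zero_eq _ (hu (k + 2) (by omega) ω), choiceTwo]
  push_cast
  ring

end Chain

/-! ### Variance and asymptotic normality -/

theorem theorem3p2 {Ω : Type*} [MeasurableSpace Ω] (μ : Measure Ω) [IsProbabilityMeasure μ]
    (u : ℕ → Ω → Fin 5) (p₁ p₂ : ℝ)
    (hu_meas : ∀ n, 1 ≤ n → Measurable (u n))
    (hu_ne : ∀ n, 2 ≤ n → ∀ ω, u n ω ≠ 0)
    (hindep : iIndepFun
      (fun (n : {n : ℕ // 2 ≤ n}) (ω : Ω) => (choiceOne u n ω, choiceTwo u n ω)) μ)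
    (hZ₁ : ∀ n, 2 ≤ n →
      μ.real {ω | choiceOne u n ω = 1} = p₁ ∧ μ.real {ω | choiceOne u n ω = 0} = 1 - p₁)
    (hZ₂ : ∀ n, 2 ≤ n →
      μ.real {ω | choiceTwo u n ω = 1} = p₂ ∧ μ.real {ω | choiceTwo u n ω = 0} = 1 - p₂)
    (hp₁ : 0 < p₁ ∧ p₁ < 1) (hp₂ : 0 < p₂ ∧ p₂ < 1) :
    (∀ n, 2 ≤ n →
      Var[fun ω => 240 * choiceOne u n ω + 360 * choiceTwo u n ω; μ] = sigmaSq p₁ ∧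
      Var[fun ω => 113 * choiceOne u n ω + 233 * choiceTwo u n ω; μ] = sigmaTildeSq p₁ ∧
      cov[fun ω => 240 * choiceOne u n ω + 360 * choiceTwo u n ω,
        fun ω => 113 * choiceOne u n ω + 233 * choiceTwo u n ω; μ] = rTwo p₁) ∧
    (∀ n, 1 ≤ n →
      MemLp (schultzPG u n) 2 μ ∧
      Var[schultzPG u n; μ] = 1 / 30 *
        (sigmaSq p₁ * (n : ℝ) ^ 5 - 5 * rTwo p₁ * (n : ℝ) ^ 4 + 10 * sigmaTildeSq p₁ * (n : ℝ) ^ 3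
          + (65 * rTwo p₁ - 30 * sigmaSq p₁ - 45 * sigmaTildeSq p₁) * (n : ℝ) ^ 2
          + (59 * sigmaSq p₁ + 65 * sigmaTildeSq p₁ - 120 * rTwo p₁) * (n : ℝ)
          + (60 * rTwo p₁ - 30 * sigmaSq p₁ - 30 * sigmaTildeSq p₁))) ∧
    Tendsto
      (fun n : ℕ => ⨆ a : ℝ,
        |μ.real {ω | (schultzPG u n ω - ∫ ω', schultzPG u n ω' ∂μ) /
            Real.sqrt (Var[schultzPG u n; μ]) ≤ a} -
          ∫ t in Set.Iic a, 1 / Real.sqrt (2 * Real.pi) * Real.exp (-t ^ 2 / 2)|)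
      atTop (𝓝 0) := by
  have hmeas : ∀ n, 2 ≤ n → Measurable (choiceTwo u n) := fun n hn =>
    measurable_choiceTwo (hu_meas n (by omega))
  have hL2 : ∀ n, 2 ≤ n → MemLp (choiceTwo u n) 2 μ := fun n hn =>
    memLp_of_zero_or_one (hmeas n hn) (choiceTwo_zero_or_one n) 2
  have hE : ∀ n, 2 ≤ n → ∫ ω, choiceTwo u n ω ∂μ = p₂ := fun n hn =>
    integral_of_zero_or_one (hmeas n hn) (choiceTwo_zero_or_one n) (hZ₂ n hn).1
  have hV : ∀ n, 2 ≤ n → Var[choiceTwo u n; μ] = p₂ * (1 - p₂) := fun n hn =>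
    variance_of_zero_or_one (hmeas n hn) (choiceTwo_zero_or_one n) (hZ₂ n hn).1
  have hp : p₁ = 1 - p₂ := by
    rw [← (hZ₁ 2 le_rfl).1, ← (hZ₂ 2 le_rfl).2]
    congr 1
    ext ω
    simp [choiceOne_eq_one_sub (hu_ne 2 le_rfl ω)]
  -- All three parameters coincide because `360 - 240 = 233 - 113 = 120`.
  have hσ : sigmaSq p₁ = 120 ^ 2 * (p₂ * (1 - p₂)) := by rw [sigmaSq, hp]; ring
  have hσ' : sigmaTildeSq p₁ = 120 ^ 2 * (p₂ * (1 - p₂)) := by rw [sigmaTildeSq, hp]; ring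
  have hr : rTwo p₁ = 120 ^ 2 * (p₂ * (1 - p₂)) := by rw [rTwo, hp]; ring
  have hInd : iIndepFun (fun k : ℕ => choiceTwo u (k + 2)) μ := by
    have h1 : iIndepFun (fun (n : {n : ℕ // 2 ≤ n}) => choiceTwo u n) μ :=
      hindep.comp (fun _ x => x.2) (fun _ => measurable_snd)
    exact h1.precomp (g := fun k : ℕ => (⟨k + 2, by omega⟩ : {n : ℕ // 2 ≤ n}))
      (fun a b hab => by simpa using hab)
  have hpos : 0 < p₂ * (1 - p₂) := mul_pos hp₂.1 (by linarith)
  have hterm : ∀ (c : ℝ) (k : ℕ), MemLp (fun ω => c * choiceTwo u (k + 2) ω) 2 μ :=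
    fun c k => (hL2 (k + 2) (by omega)).const_mul c
  have hsumL2 : ∀ (K : ℕ) (w : ℕ → ℝ),
      MemLp (fun ω => ∑ k ∈ Finset.range K, w k * choiceTwo u (k + 2) ω) 2 μ := fun K w =>
    memLp_finsetSum _ fun k _ => hterm _ k
  have hsumVar : ∀ (K : ℕ) (w : ℕ → ℝ),
      Var[fun ω => ∑ k ∈ Finset.range K, w k * choiceTwo u (k + 2) ω; μ] =
        p₂ * (1 - p₂) * ∑ k ∈ Finset.range K, w k ^ 2 := by
    intro K w
    have := IndepFun.variance_sum (X := fun k ω => w k * choiceTwo u (k + 2) ω)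
      (s := Finset.range K) (μ := μ) (fun k _ => hterm _ k) (by
        intro i _ j _ hij
        exact (hInd.indepFun hij).comp (φ := fun x => w i * x) (ψ := fun x => w j * x)
          (by fun_prop) (by fun_prop))
    have e : (fun ω => ∑ k ∈ Finset.range K, w k * choiceTwo u (k + 2) ω) =
        ∑ k ∈ Finset.range K, fun ω => w k * choiceTwo u (k + 2) ω := by
      ext ω; simp
    rw [e, this, Finset.mul_sum]
    refine Finset.sum_congr rfl fun k _ => ?_
    rw [variance_const_mul, hV _ (by omega), mul_comm]
  have hSVar : ∀ K : ℕ, Var[schultzPG u (K + 2); μ] = 120 ^ 2 * (p₂ * (1 - p₂)) *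
      ∑ k ∈ Finset.range K, ((k + 1 : ℝ) * (K - k)) ^ 2 := by
    intro K
    obtain ⟨C, hC⟩ := exists_schultzPG_eq hu_ne K
    rw [funext hC, variance_const_add ((hsumL2 K _).const_mul _).aestronglyMeasurable,
      variance_const_mul, hsumVar]
    ring
  refine ⟨fun n hn => ?_, fun n hn => ?_, ?_⟩
  · have e : ∀ a b : ℝ, (fun ω => a * choiceOne u n ω + b * choiceTwo u n ω) =
        fun ω => a + (b - a) * choiceTwo u n ω := by
      intro a b
      ext ω
      rw [choiceOne_eq_one_sub (hu_ne n hn ω)]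
      ring
    have hm : ∀ c : ℝ, MemLp (fun ω => c * choiceTwo u n ω) 2 μ := fun c => (hL2 n hn).const_mul c
    have hi : ∀ c : ℝ, Integrable (fun ω => c * choiceTwo u n ω) μ := fun c =>
      (hm c).integrable one_le_two
    simp only [e]
    refine ⟨?_, ?_, ?_⟩
    · rw [variance_const_add (hm _).aestronglyMeasurable, variance_const_mul, hV n hn, hσ]
      norm_num
    · rw [variance_const_add (hm _).aestronglyMeasurable, variance_const_mul, hV n hn, hσ']
      norm_num
    · rw [covariance_const_add_left (hi _), covariance_const_add_right (hi _),
        covariance_const_mul_left, covariance_const_mul_right,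
        covariance_self (hmeas n hn).aemeasurable, hV n hn, hr]
      ring
  · rw [hσ, hσ', hr]
    obtain rfl | ⟨K, rfl⟩ : n = 1 ∨ ∃ K, n = K + 2 := by
      rcases Nat.lt_or_ge n 2 with h | h
      · left; omega
      · right; exact ⟨n - 2, by omega⟩
    · obtain ⟨C, hC⟩ := exists_schultzPG_one_eq u
      rw [funext hC]
      refine ⟨memLp_const C, ?_⟩
      rw [variance_eq_integral aemeasurable_const]
      simp
      ring
    · constructor
      · obtain ⟨C, hC⟩ := exists_schultzPG_eq hu_ne K
        rw [funext hC]
        exact (memLp_const C).add ((hsumL2 K _).const_mul _)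
      -- With equal parameters the polynomial is a multiple of `(n - 1)⁵ - (n - 1)`, where `n - 1 =
      -- K + 1`.
      · rw [hSVar, sum_sq_succ_mul_sub]
        push_cast
        ring
  -- For `n ≤ 2` the index is constant; from `n = 3` on the variance is positive.
  · rw [← tendsto_add_atTop_iff_nat 3]
    set s : ℝ := Real.sqrt (p₂ * (1 - p₂)) with hs
    have hs0 : 0 < s := Real.sqrt_pos.2 hpos
    have hs2 : s ^ 2 = p₂ * (1 - p₂) := Real.sq_sqrt hpos.le
    let X : ℕ → Ω → ℝ := fun k ω => (choiceTwo u (k + 2) ω - p₂) / s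
    have hX : ∀ k, Measurable (X k) := fun k => ((hmeas (k + 2) (by omega)).sub_const _).div_const _
    -- The right-hand side does not depend on `k`, so all `X k` have the same characteristic
    -- function and moments.
    have hcomp : ∀ {E : Type} [NormedAddCommGroup E] [NormedSpace ℝ E] [CompleteSpace E] (k : ℕ)
        (f : ℝ → E), ∫ ω, f (X k ω) ∂μ =
          f ((0 - p₂) / s) + p₂ • (f ((1 - p₂) / s) - f ((0 - p₂) / s)) :=
      fun k f => integral_comp_of_zero_or_one (hmeas (k + 2) (by omega)) (choiceTwo_zero_or_one _)
        (hZ₂ (k + 2) (by omega)).1 fun x => f ((x - p₂) / s)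
    have hchar : ∀ k, charFun (μ.map (X k)) = charFun (μ.map (X 0)) := by
      intro k
      ext t
      rw [charFun_apply_real, charFun_apply_real, integral_map (hX k).aemeasurable (by fun_prop),
        integral_map (hX 0).aemeasurable (by fun_prop),
        hcomp k fun x => Complex.exp (t * x * Complex.I), hcomp 0 fun x => Complex.exp (t * x * Complex.I)]
    have hX0 : μ[X 0] = 0 := by
      rw [hcomp 0 fun x => x]
      simp only [smul_eq_mul]
      ring
    have hX1 : μ[X 0 ^ 2] = 1 := by
      change ∫ ω, (X 0 ω) ^ 2 ∂μ = 1
      rw [hcomp 0 fun x => x ^ 2]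
      simp only [smul_eq_mul, div_pow, hs2]
      have h1 : p₂ ≠ 0 := hp₂.1.ne'
      have h2 : 1 - p₂ ≠ 0 := by linarith
      field_simp
      ring
    have hXind : iIndepFun X μ := hInd.comp (fun _ x => (x - p₂) / s) (fun _ => by fun_prop)
    let W : ℕ → ℝ := fun K => ∑ k ∈ Finset.range (K + 1), ((k + 1 : ℝ) * ((K + 1 : ℕ) - k)) ^ 2
    have hW : ∀ K, 0 < W K := sum_sq_pos
    let c : ℕ → ℕ → ℝ := fun K k => (k + 1 : ℝ) * ((K + 1 : ℕ) - k) / Real.sqrt (W K)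
    have hc : ∀ K, ∑ k ∈ Finset.range (K + 1), c K k ^ 2 = 1 := by
      intro K
      simp only [c, div_pow, Real.sq_sqrt (hW K).le]
      rw [← Finset.sum_div]
      exact div_self (hW K).ne'
    have hnorm : ∀ K ω, (schultzPG u (K + 3) ω - ∫ ω', schultzPG u (K + 3) ω' ∂μ) /
        Real.sqrt (Var[schultzPG u (K + 3); μ]) = ∑ k ∈ Finset.range (K + 1), c K k * X k ω := by
      intro K ω
      have hsq : Real.sqrt (Var[schultzPG u (K + 3); μ]) = 120 * s * Real.sqrt (W K) := by
        rw [hSVar (K + 1), Real.sqrt_mul (by positivity), Real.sqrt_mul (by positivity),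
          Real.sqrt_sq (by norm_num)]
      obtain ⟨C, hC⟩ := exists_schultzPG_eq hu_ne (K + 1)
      have hmean : ∫ ω', schultzPG u (K + 3) ω' ∂μ =
          C + 120 * ∑ k ∈ Finset.range (K + 1), ((k + 1 : ℝ) * ((K + 1 : ℕ) - k)) * p₂ := by
        change ∫ ω', schultzPG u (K + 1 + 2) ω' ∂μ = _
        simp only [hC]
        rw [integral_add (integrable_const _)
          (((hsumL2 _ _).integrable one_le_two).const_mul _), integral_const_mul,
          integral_finsetSum _ fun k _ => (hterm _ k).integrable one_le_two]
        simp only [integral_const_mul, hE _ (Nat.le_add_left 2 _)]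
        simp
      rw [hsq, hmean, show K + 3 = K + 1 + 2 from rfl, hC, add_sub_add_left_eq_sub, ← mul_sub,
        ← Finset.sum_sub_distrib, mul_assoc, mul_div_mul_left _ _ (by norm_num), Finset.sum_div]
      refine Finset.sum_congr rfl fun k _ => ?_
      simp only [c, X]
      have := (Real.sqrt_pos.2 (hW K)).ne'
      field_simp
    simp only [hnorm]
    refine tendsto_iSup_abs_sub_gaussian (fun K => ?_) fun t => ?_
    · exact Finset.measurable_fun_sum _ fun k _ => (hX k).const_mul _
    · exact tendsto_charFun_weighted_sum hX hXind hchar hX0 hX1 c (fun K => K + 1) hc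
        eventually_abs_weight_lt t
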